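/- Let $m_0\in\mathbb R$, let $V$ be a real-valued function that is real-analytic in a neighborhood of $m_0$ with $V(m_0)>0$, and let $\nu$ be a probability measure on $\mathbb R$ with finite moments of all orders and mean $\int x\,\nu(dx)=m_0$. The free cumulants $c_n=c_n(\nu)$, $n\ge 1$, are the coefficients of the $R$-transform $R_\nu(z)=K_\nu(z)-\frac1z=\sum_{n\ge1}c_n z^{n-1}$, where $K_\nu$ is the compositional inverse of the Cauchy-Stieltjes transform $G_\nu(z)=\int\frac{1}{z-x}\,\nu(dx)\sim\sum_{n\ge0}z^{-n-1}\int x^n\,\nu(dx)$ (expansion at $z=\infty$, taken as a formal series if $\nu$ is not compactly supported). Then the following conditions are equivalent. (i) $\nu$ is non-degenerate (not a point mass) and compactly supported, and there is an open interval $(A,B)\ni m_0$ such that $$Q_m(dx)=\frac{V(m)}{V(m)+(m-m_0)(m-x)}\,\nu(dx),\qquad m\in(A,B),$$ are well-defined probability measures, parameterized by the mean and with variance function $V$: $\int x\,Q_m(dx)=m$ and $\int (x-m)^2\,Q_m(dx)=V(m)$ for all $m\in(A,B)$. (That is, $\nu$ generates a free exponential family with variance function $V$.) (ii) $c_1=m_0$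 and, for all $n\ge1$, $$c_{n+1}=\frac1{n!}\,\frac{d^{n-1}}{dx^{n-1}}\bigl(V(x)\bigr)^n\Big|_{x=m_0}.$$ -/

import Mathlib

open MeasureTheory

noncomputable section

namespace FreeExponentialFamily

/-! Free cumulants.  For a probability measure `ν` with all moments, the expansion at infinity of the
Cauchy-Stieltjes transform `G_ν(z) = ∫ 1/(z-x) ν(dx)` is `∑ n, (∫ xⁿ ν(dx)) z^(-n-1)`; it is a
convergent expansion when `ν` has compact support, and is read as a formal series otherwise.
All series below are formal ones. -/

/-- The moment generating series `M_ν(w) = ∑ n, (∫ xⁿ ν(dx)) wⁿ`. -/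
def momentSeries (ν : Measure ℝ) : PowerSeries ℝ :=
  PowerSeries.mk fun n => ∫ x, x ^ n ∂ν

/-- The expansion of the Cauchy-Stieltjes transform `G_ν` at infinity, as a power series in the
variable `w = 1/z`: `G_ν(1/w) = w M_ν(w) = ∑ n, (∫ xⁿ ν(dx)) w^(n+1)`. -/
def cauchySeries (ν : Measure ℝ) : PowerSeries ℝ :=
  PowerSeries.X * momentSeries ν

theorem isUnit_coeff_one_cauchySeries (ν : Measure ℝ) [IsProbabilityMeasure ν] :
    IsUnit (PowerSeries.coeff 1 (cauchySeries ν)) := by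
  simp [cauchySeries, momentSeries]

/-- The compositional inverse of `w ↦ G_ν(1/w)`. -/
def cauchySeriesInv (ν : Measure ℝ) [IsProbabilityMeasure ν] : PowerSeries ℝ :=
  (cauchySeries ν).substInvOfIsUnit (isUnit_coeff_one_cauchySeries ν)

/-- The inverse function `K_ν` of `G_ν`, as a formal Laurent series at `0`:
`G_ν(1/w) = z` exactly when `1/w = K_ν(z)`, so `K_ν` is the reciprocal of `cauchySeriesInv ν`. -/
def kSeries (ν : Measure ℝ) [IsProbabilityMeasure ν] : LaurentSeries ℝ :=
  (HahnSeries.ofPowerSeries ℤ ℝ (cauchySeriesInv ν))⁻¹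

/-- The `R`-transform `R_ν(z) = K_ν(z) - 1/z`. -/
def rSeries (ν : Measure ℝ) [IsProbabilityMeasure ν] : LaurentSeries ℝ :=
  kSeries ν - HahnSeries.single (-1) 1

/-- The free cumulants `c_n(ν)`, given by `R_ν(z) = ∑_{n ≥ 1} c_n(ν) z^(n-1)`. -/
def freeCumulant (ν : Measure ℝ) [IsProbabilityMeasure ν] (n : ℕ) : ℝ :=
  (rSeries ν).coeff ((n : ℤ) - 1)

/-! Free exponential families. -/

/-- The density `V(m) / (V(m) + (m - m₀)(m - x))`. -/
def density (V : ℝ → ℝ) (m₀ m x : ℝ) : ℝ :=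
  V m / (V m + (m - m₀) * (m - x))

/-- The measure `Q_m(dx) = V(m) / (V(m) + (m - m₀)(m - x)) ν(dx)`. -/
def member (ν : Measure ℝ) (V : ℝ → ℝ) (m₀ m : ℝ) : Measure ℝ :=
  ν.withDensity fun x => ENNReal.ofReal (density V m₀ m x)

/-- The measures `Q_m`, for `m` in the interval `(A, B)` around `m₀`, form a family of probability
measures that is parameterized by the mean and has the variance function `V`.  The first condition
says that the densities are well defined and nonnegative, so that `member` is `Q_m`. -/
structure IsFamily (ν : Measure ℝ) (V : ℝ → ℝ) (m₀ A B : ℝ) : Prop where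
  mem_interval : m₀ ∈ Set.Ioo A B
  density_ok : ∀ m ∈ Set.Ioo A B,
    ∀ᵐ x ∂ν, V m + (m - m₀) * (m - x) ≠ 0 ∧ 0 ≤ density V m₀ m x
  isProbabilityMeasure : ∀ m ∈ Set.Ioo A B, IsProbabilityMeasure (member ν V m₀ m)
  memLp_two : ∀ m ∈ Set.Ioo A B, MemLp (fun x : ℝ => x) 2 (member ν V m₀ m)
  mean_eq : ∀ m ∈ Set.Ioo A B, ∫ x, x ∂(member ν V m₀ m) = m
  variance_eq : ∀ m ∈ Set.Ioo A B, ∫ x, (x - m) ^ 2 ∂(member ν V m₀ m) = V m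

/-- `ν` is non-degenerate, compactly supported, and generates a free exponential family with
variance function `V` on some interval around `m₀`. -/
def Generates (ν : Measure ℝ) (V : ℝ → ℝ) (m₀ : ℝ) : Prop :=
  (∀ a : ℝ, ν ≠ Measure.dirac a) ∧ IsCompact ν.support ∧ ∃ A B : ℝ, IsFamily ν V m₀ A B

end FreeExponentialFamily

end

/-! Put `m = m₀ + t`. The density of `Q_m` is, up to a factor free of `x`, the Cauchy kernel `1/(z -
x)` at `z = m + V(m)/(m - m₀)`. With `w(t) = 1/z = t/(V(m) + m t)` and `φ(t) = t/V(m)`, total mass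
one of `Q_m` for small `t ≠ 0` therefore says `G_ν(1/w(t)) = φ(t)`. Both conditions of the theorem
are compared with the formal identity `cauchySeries ν ∘ w = φ`.

On the cumulant side, let `h` be the compositional inverse of `φ`. At `t = h(z)` the identity reads
`K_ν(z) = m₀ + h(z) + 1/z`, that is `R_ν = m₀ + h`, and Lagrange inversion of `φ = X/v`, with `v`
the Taylor series of `V` at `m₀`, gives the stated coefficients
(`subst_cauchySeries_eq_iff_freeCumulant`).

On the measure side, a family yields the identity by comparing expansions at `0`. Conversely, the
identity makes `cauchySeries ν` the Taylor series of the analytic germ `φ ∘ w⁻¹`. The moments then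
grow at most geometrically, so `ν` has compact support and the germ is its Cauchy transform; hence
the densities have integral one. Mean and variance follow from mass one by integrating the relation
`ρ (V(m) + (m - m₀)(m - x)) = V(m)` for the density `ρ`, as it stands and multiplied by `m - x`. -/

namespace FreeExponentialFamily

/-! ### Formal Lagrange inversion. -/

open PowerSeries

/-- The kernel of Lagrange inversion: `φ^k φ' v^(n+1)` has `n`-th coefficient `δ_{kn}` when
`φ v = X`. -/
theorem coeff_pow_mul_derivative_mul_pow {v φ : PowerSeries ℝ} (hφ : φ * v = X)
    (hφ₀ : constantCoeff φ = 0) {n k : ℕ} (hk : k ≤ n) :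
    coeff n (φ ^ k * (derivative ℝ φ * v ^ (n + 1))) = if k = n then 1 else 0 := by
  obtain ⟨j, rfl⟩ := Nat.exists_eq_add_of_le hk
  have h1 : φ ^ k * (derivative ℝ φ * v ^ (k + j + 1)) =
      X ^ k * (v ^ j * (derivative ℝ φ * v)) := by
    rw [← hφ]; ring
  have h2 : derivative ℝ φ * v = 1 - φ * derivative ℝ v := by
    have := congrArg (derivative ℝ) hφ
    rw [Derivation.leibniz, derivative_X] at this
    simp only [smul_eq_mul] at this
    linear_combination this
  rw [h1, h2, add_comm k j, coeff_X_pow_mul]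
  rcases j with _ | j
  · simp [hφ₀]
  -- For positive `j = n - k` the coefficient vanishes because `v ^ j * v'` is `(v ^ (j + 1))' / (j
  -- + 1)`: the residue of a derivative is zero.
  · have h3 : v ^ (j + 1) * (1 - φ * derivative ℝ v) =
        v ^ (j + 1) - X * (v ^ j * derivative ℝ v) := by
      rw [← hφ]; ring
    have h4 : derivative ℝ (v ^ (j + 1)) = (j + 1 : ℝ) • (v ^ j * derivative ℝ v) := by
      rw [derivative_pow, smul_eq_C_mul]
      simp
      ring
    have h5 := congrArg (coeff j) h4
    rw [coeff_derivative, coeff_smul] at h5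
    have : (j + 1 : ℝ) ≠ 0 := by positivity
    have h6 : coeff (j + 1) (v ^ (j + 1)) = coeff j (v ^ j * derivative ℝ v) := by
      apply mul_left_cancel₀ this
      rw [smul_eq_mul] at h5
      linarith
    rw [h3, map_sub, coeff_succ_X_mul, h6, sub_self, if_neg (by omega)]

/-- Change of variable `x = φ(t)` in the residue of `q(x)/x^(n+1)`, since `1/φ = v/X`. Modulo `X ^
(n + 1)` only a truncation of `q` matters, and each of its monomials is the kernel computation
above. -/
theorem coeff_subst_mul_derivative_mul_pow {v φ : PowerSeries ℝ} (hφ : φ * v = X)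
    (hφ₀ : constantCoeff φ = 0) (q : PowerSeries ℝ) (n : ℕ) :
    coeff n (q.subst φ * (derivative ℝ φ * v ^ (n + 1))) = coeff n q := by
  have hs : HasSubst φ := HasSubst.of_constantCoeff_zero' hφ₀
  have hdvd : (X : PowerSeries ℝ) ^ (n + 1) ∣ φ ^ (n + 1) := pow_dvd_pow_of_dvd (X_dvd_iff.2 hφ₀) _
  obtain ⟨s, hq⟩ : ∃ s : PowerSeries ℝ,
      q = X ^ (n + 1) * s + ((trunc (n + 1) q : Polynomial ℝ) : PowerSeries ℝ) :=
    ⟨_, eq_X_pow_mul_shift_add_trunc (n + 1) q⟩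
  have h1 : q.subst φ = φ ^ (n + 1) * s.subst φ +
      ∑ i ∈ Finset.range (n + 1), C (coeff i q) * φ ^ i := by
    conv_lhs => rw [hq]
    rw [subst_add hs, subst_mul hs, subst_pow hs, subst_X hs, subst_coe hs,
      Polynomial.aeval_def, eval₂_trunc_eq_sum_range]
    rfl
  rw [h1, add_mul, map_add, Finset.sum_mul, map_sum, X_pow_dvd_iff.1 (Dvd.dvd.mul_right
    (hdvd.mul_right _) _) n (Nat.lt_succ_self n), zero_add]
  have h2 : ∀ i ∈ Finset.range (n + 1),
      coeff n (C (coeff i q) * φ ^ i * (derivative ℝ φ * v ^ (n + 1))) =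
        if i = n then coeff i q else 0 := by
    intro i hi
    rw [mul_assoc, coeff_C_mul, coeff_pow_mul_derivative_mul_pow hφ hφ₀
      (Nat.lt_succ_iff.1 (Finset.mem_range.1 hi))]
    simp
  rw [Finset.sum_congr rfl h2]
  simp

/-- Lagrange inversion: the compositional inverse `h` of `φ = X / v`. -/
theorem lagrange_inversion {v φ h : PowerSeries ℝ} (hφ : φ * v = X)
    (hφ₀ : constantCoeff φ = 0) (hh : h.subst φ = X) (n : ℕ) :
    coeff (n + 1) h * (n + 1) = coeff n (v ^ (n + 1)) := by
  have hs : HasSubst φ := HasSubst.of_constantCoeff_zero' hφ₀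
  -- Differentiating `h ∘ φ = X` lets the residue formula, applied to `q = h'`, collapse to a
  -- coefficient of `v ^ (n + 1)`.
  have h1 : (derivative ℝ h).subst φ * derivative ℝ φ = 1 := by
    rw [← derivative_subst hs, hh, derivative_X]
  rw [← coeff_derivative, ← coeff_subst_mul_derivative_mul_pow hφ hφ₀, ← mul_assoc, h1, one_mul]

/-! ### Free cumulants and the formal functional equation. -/

variable (ν : Measure ℝ) [IsProbabilityMeasure ν]

theorem constantCoeff_cauchySeries (ν : Measure ℝ) : constantCoeff (cauchySeries ν) = 0 := by
  simp [cauchySeries]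

/-- The part of the `R`-transform with nonnegative exponents. -/
theorem exists_powerSeries_freeCumulant :
    ∃ R : PowerSeries ℝ, cauchySeriesInv ν * (1 + X * R) = X ∧
      ∀ n, freeCumulant ν (n + 1) = coeff n R := by
  obtain ⟨u, hu⟩ : X ∣ cauchySeriesInv ν := X_dvd_iff.2 (by simp [cauchySeriesInv])
  have hu₀ : constantCoeff u = 1 := by
    have h1 : coeff 1 (cauchySeriesInv ν) = 1 := by
      have : IsUnit.unit (isUnit_coeff_one_cauchySeries ν) = 1 := by
        ext
        simp [cauchySeries, momentSeries]
      rw [cauchySeriesInv, coeff_one_substInvOfIsUnit, this]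
      simp
    rw [hu] at h1
    simpa using h1
  have hu₁ : constantCoeff u ≠ 0 := by simp [hu₀]
  obtain ⟨R, hR⟩ : X ∣ u⁻¹ - 1 := X_dvd_iff.2 (by simp [hu₀])
  have hR' : 1 + X * R = u⁻¹ := by rw [← hR]; ring
  refine ⟨R, by rw [hR', hu, mul_assoc, PowerSeries.mul_inv_cancel u hu₁, mul_one], fun n => ?_⟩
  have hk : kSeries ν = HahnSeries.single (-1 : ℤ) (1 : ℝ) +
      HahnSeries.ofPowerSeries ℤ ℝ R := by
    rw [kSeries]
    apply inv_eq_of_mul_eq_one_right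
    have h2 : (HahnSeries.single (-1 : ℤ) (1 : ℝ) + HahnSeries.ofPowerSeries ℤ ℝ R) =
        HahnSeries.single (-1 : ℤ) (1 : ℝ) * HahnSeries.ofPowerSeries ℤ ℝ (1 + X * R) := by
      rw [map_add, map_mul, map_one (HahnSeries.ofPowerSeries ℤ ℝ), HahnSeries.ofPowerSeries_X,
        mul_add, mul_one, ← mul_assoc, HahnSeries.single_mul_single]
      simp
    have h3 : HahnSeries.ofPowerSeries ℤ ℝ (cauchySeriesInv ν) *
        HahnSeries.ofPowerSeries ℤ ℝ (1 + X * R) = HahnSeries.single 1 1 := by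
      rw [← map_mul, hR', hu, mul_assoc, PowerSeries.mul_inv_cancel u hu₁, mul_one,
        HahnSeries.ofPowerSeries_X]
    rw [h2, mul_left_comm, h3, HahnSeries.single_mul_single]
    simp
  rw [freeCumulant, rSeries, hk]
  simp only [add_sub_cancel_left]
  push_cast
  rw [add_sub_cancel_right]
  exact HahnSeries.ofPowerSeries_apply_coeff R n

/-- Substituting `h` in `φ v = X` gives `X · (v ∘ h) = h`, so `w ∘ h = X / (1 + X (m₀ + h))`. This
has the form of `hR`, which gives `cauchySeriesInv ν = X / (1 + X R)`; and `cauchySeries ν ∘ w = φ`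
means exactly `w ∘ h = cauchySeriesInv ν`. -/
theorem subst_cauchySeries_eq_iff {v φ w h : PowerSeries ℝ} {m₀ : ℝ} (hv : constantCoeff v ≠ 0)
    (hφ : φ * v = X) (hw : w * (v + (C m₀ + X) * X) = X) (hφ₀ : constantCoeff φ = 0)
    (hw₀ : constantCoeff w = 0) (hh₀ : constantCoeff h = 0)
    (hh : h.subst φ = X) (hh' : φ.subst h = X) {R : PowerSeries ℝ}
    (hR : cauchySeriesInv ν * (1 + X * R) = X) :
    (cauchySeries ν).subst w = φ ↔ R = C m₀ + h := by
  have sφ : HasSubst φ := HasSubst.of_constantCoeff_zero' hφ₀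
  have sw : HasSubst w := HasSubst.of_constantCoeff_zero' hw₀
  have sh : HasSubst h := HasSubst.of_constantCoeff_zero' hh₀
  have sG : HasSubst (cauchySeries ν) :=
    HasSubst.of_constantCoeff_zero' (constantCoeff_cauchySeries ν)
  have sg : HasSubst (cauchySeriesInv ν) := HasSubst.substInvOfIsUnit _ _
  have hGg : (cauchySeries ν).subst (cauchySeriesInv ν) = X :=
    subst_substInvOfIsUnit_right _ (constantCoeff_cauchySeries ν) _
  have hgG : (cauchySeriesInv ν).subst (cauchySeries ν) = X :=
    subst_substInvOfIsUnit_left _ (constantCoeff_cauchySeries ν) _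
  have hCsubst : ∀ r : ℝ, (C r : PowerSeries ℝ).subst h = C r := fun r => subst_C r
  have e1 : X * v.subst h = h := by
    have := congrArg (subst h) hφ
    rwa [subst_mul sh, hh', subst_X sh] at this
  have e2 : w.subst h * (v.subst h + (C m₀ + h) * h) = h := by
    have := congrArg (subst h) hw
    rwa [subst_mul sh, subst_add sh, subst_mul sh, subst_add sh, hCsubst, subst_X sh] at this
  have hvh : constantCoeff (v.subst h : PowerSeries ℝ) ≠ 0 := by
    obtain ⟨v', hv'⟩ : X ∣ v - C (constantCoeff v) := X_dvd_iff.2 (by simp)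
    have : (v.subst h : PowerSeries ℝ) = C (constantCoeff v) + h * v'.subst h := by
      rw [sub_eq_iff_eq_add'] at hv'
      conv_lhs => rw [hv']
      rw [subst_add sh, subst_mul sh, subst_X sh, hCsubst]
    rw [this]
    simpa [hh₀] using hv
  have hvh' : (v.subst h : PowerSeries ℝ) ≠ 0 := fun h0 => hvh (by rw [h0]; simp)
  constructor
  · intro hG
    have e3 : w = (cauchySeriesInv ν).subst φ := by
      rw [← hG, ← subst_comp_subst_apply sG sw, hgG, subst_X sw]
    have e4 : w.subst h = cauchySeriesInv ν := by
      rw [e3, subst_comp_subst_apply sφ sh, hh', X_subst]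
    rw [e4] at e2
    have e5 : cauchySeriesInv ν * (1 + X * (C m₀ + h)) = X := by
      apply mul_right_cancel₀ hvh'
      linear_combination e2 + (cauchySeriesInv ν * (C m₀ + h) - 1) * e1
    have hg0 : cauchySeriesInv ν ≠ 0 := by
      intro h0
      rw [h0, zero_mul] at hR
      exact X_ne_zero hR.symm
    have := mul_left_cancel₀ hg0 (hR.trans e5.symm)
    exact mul_left_cancel₀ X_ne_zero (add_left_cancel this)
  · intro hR'
    have e4 : w.subst h = cauchySeriesInv ν := by
      have h0 : v.subst h + (C m₀ + h) * h ≠ 0 := by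
        intro h0
        have := congrArg constantCoeff h0
        rw [map_add, map_mul, hh₀, mul_zero, add_zero, map_zero] at this
        exact hvh this
      apply mul_right_cancel₀ h0
      rw [e2]
      rw [hR'] at hR
      linear_combination (-(v.subst h)) * hR + (cauchySeriesInv ν * (C m₀ + h) - 1) * e1
    have e3 : w = (cauchySeriesInv ν).subst φ := by
      rw [← e4, subst_comp_subst_apply sh sφ, hh, X_subst]
    rw [e3, ← subst_comp_subst_apply sg sφ, hGg, subst_X sφ]

/-- The free cumulants satisfy the Lagrange formula exactly when the Cauchy series substituted
at `w = X / (v + (m₀ + X) X)` is `X / v`. -/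
theorem subst_cauchySeries_eq_iff_freeCumulant {v φ w : PowerSeries ℝ} {m₀ : ℝ}
    (hv : constantCoeff v ≠ 0) (hφ : φ * v = X) (hw : w * (v + (C m₀ + X) * X) = X) :
    (cauchySeries ν).subst w = φ ↔
      freeCumulant ν 1 = m₀ ∧ ∀ n, freeCumulant ν (n + 2) * (n + 1) = coeff n (v ^ (n + 1)) := by
  have hφ₀ : constantCoeff φ = 0 := by
    have := congrArg constantCoeff hφ
    rw [map_mul, constantCoeff_X] at this
    exact (mul_eq_zero.1 this).resolve_right hv
  have hw₀ : constantCoeff w = 0 := by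
    have := congrArg constantCoeff hw
    simp only [map_mul, map_add, constantCoeff_X, mul_zero, add_zero] at this
    exact (mul_eq_zero.1 this).resolve_right hv
  have hφ₁ : IsUnit (coeff 1 φ) := by
    obtain ⟨ψ, hψ⟩ := X_dvd_iff.2 hφ₀
    have := congrArg (coeff 1) hφ
    rw [hψ, mul_assoc, coeff_one_X, show (1 : ℕ) = 0 + 1 from rfl, coeff_succ_X_mul] at this
    rw [hψ, show (1 : ℕ) = 0 + 1 from rfl, coeff_succ_X_mul]
    simp only [coeff_zero_eq_constantCoeff, map_mul] at this ⊢
    exact (left_ne_zero_of_mul (by rw [this]; exact one_ne_zero)).isUnit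
  obtain ⟨R, hR, hc⟩ := exists_powerSeries_freeCumulant ν
  have hh := subst_substInvOfIsUnit_left φ hφ₀ hφ₁
  have hh' := subst_substInvOfIsUnit_right φ hφ₀ hφ₁
  have hh₀ := constantCoeff_substInvOfIsUnit φ hφ₁
  generalize substInvOfIsUnit φ hφ₁ = h at hh hh' hh₀
  rw [subst_cauchySeries_eq_iff ν hv hφ hw hφ₀ hw₀ hh₀ hh hh' hR]
  have hL := lagrange_inversion hφ hφ₀ hh
  have hC : ∀ n, coeff (n + 1) (C m₀ + h) = coeff (n + 1) h := fun n => by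
    rw [map_add, coeff_C, if_neg (Nat.succ_ne_zero n), zero_add]
  constructor
  · intro hRh
    refine ⟨by rw [show (1 : ℕ) = 0 + 1 from rfl, hc 0, hRh]; simp [hh₀], fun n => ?_⟩
    rw [hc (n + 1), hRh, hC, hL]
  · rintro ⟨h1, h2⟩
    ext n
    rcases n with _ | n
    · rw [← hc 0, zero_add, h1]
      simp [hh₀]
    · have h3 := h2 n
      rw [hc (n + 1), ← hL n] at h3
      rw [hC]
      exact mul_right_cancel₀ (by positivity) h3

end FreeExponentialFamily

/-! ### Asymptotic expansions at zero, linking functions with formal series. -/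

namespace FreeExponentialFamily

open PowerSeries Filter Topology Asymptotics

/-- `p` is the asymptotic expansion of `f` at `0`. -/
def HasTaylor (f : ℝ → ℝ) (p : PowerSeries ℝ) : Prop :=
  ∀ n : ℕ, ∃ P : Polynomial ℝ, X ^ n ∣ p - (P : PowerSeries ℝ) ∧
    (fun t => f t - P.eval t) =O[𝓝 0] fun t : ℝ => t ^ n

namespace HasTaylor

variable {f g : ℝ → ℝ} {p q : PowerSeries ℝ}

theorem congr (hf : HasTaylor f p) (h : f =ᶠ[𝓝 0] g) : HasTaylor g p := by
  intro n
  obtain ⟨P, h1, h2⟩ := hf n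
  exact ⟨P, h1, h2.congr' (h.mono fun t ht => by simp [ht]) EventuallyEq.rfl⟩

theorem polynomial (P : Polynomial ℝ) : HasTaylor (fun t => P.eval t) P := fun n =>
  ⟨P, by simp, by simpa using isBigO_zero _ _⟩

theorem const (a : ℝ) : HasTaylor (fun _ => a) (C a) := by
  simpa using polynomial (Polynomial.C a)

theorem id : HasTaylor (fun t => t) X := by
  simpa using polynomial Polynomial.X

theorem add (hf : HasTaylor f p) (hg : HasTaylor g q) :
    HasTaylor (fun t => f t + g t) (p + q) := by
  intro n
  obtain ⟨P, h1, h2⟩ := hf n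
  obtain ⟨Q, h3, h4⟩ := hg n
  refine ⟨P + Q, ?_, ?_⟩
  · convert dvd_add h1 h3 using 1
    push_cast
    ring
  · refine (h2.add h4).congr_left fun t => ?_
    rw [Polynomial.eval_add]
    ring

theorem isBigO_eval_one (P : Polynomial ℝ) :
    (fun t => P.eval t) =O[𝓝 0] fun _ : ℝ => (1 : ℝ) :=
  (P.continuous.continuousAt (x := (0 : ℝ))).isBigO_one ℝ

theorem isBigO_one (hf : HasTaylor f p) : f =O[𝓝 0] fun _ : ℝ => (1 : ℝ) := by
  obtain ⟨P, -, h2⟩ := hf 0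
  simp only [pow_zero] at h2
  exact (h2.add (isBigO_eval_one P)).congr_left fun t => by ring

theorem mul (hf : HasTaylor f p) (hg : HasTaylor g q) :
    HasTaylor (fun t => f t * g t) (p * q) := by
  intro n
  obtain ⟨P, h1, h2⟩ := hf n
  obtain ⟨Q, h3, h4⟩ := hg n
  refine ⟨P * Q, ?_, ?_⟩
  · convert dvd_add (h1.mul_right q) (h3.mul_left (P : PowerSeries ℝ)) using 1
    push_cast
    ring
  · have h5 := h2.mul hg.isBigO_one
    have h6 := (isBigO_eval_one P).mul h4
    simp only [mul_one, one_mul] at h5 h6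
    refine (h5.add h6).congr_left fun t => ?_
    rw [Polynomial.eval_mul]
    ring

theorem pow (hf : HasTaylor f p) (n : ℕ) : HasTaylor (fun t => f t ^ n) (p ^ n) := by
  induction n with
  | zero => simpa using const 1
  | succ n ih => simpa only [pow_succ] using ih.mul hf

theorem polynomial_comp (hg : HasTaylor g q) (P : Polynomial ℝ) :
    HasTaylor (fun t => P.eval (g t)) (Polynomial.aeval q P) := by
  induction P using Polynomial.induction_on' with
  | add P Q hP hQ => simpa only [Polynomial.eval_add, map_add] using hP.add hQ
  | monomial n a =>
    simp only [Polynomial.eval_monomial, Polynomial.aeval_monomial]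
    exact (const a).mul (hg.pow n)

theorem isBigO_id (hg : HasTaylor g q) (hq : constantCoeff q = 0) :
    g =O[𝓝 0] fun t : ℝ => t := by
  obtain ⟨Q, h1, h2⟩ := hg 1
  rw [pow_one, X_dvd_iff, map_sub, hq, zero_sub, neg_eq_zero] at h1
  simp only [pow_one] at h2
  obtain ⟨S, rfl⟩ : Polynomial.X ∣ Q := by
    rw [Polynomial.X_dvd_iff]
    simpa using h1
  have h3 := (isBigO_refl (fun t : ℝ => t) (𝓝 0)).mul (isBigO_eval_one S)
  simp only [mul_one] at h3
  exact (h2.add h3).congr_left fun t => by simp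

theorem tendsto_zero (hg : HasTaylor g q) (hq : constantCoeff q = 0) :
    Tendsto g (𝓝 0) (𝓝 0) :=
  (hg.isBigO_id hq).trans_tendsto tendsto_id

theorem comp (hf : HasTaylor f p) (hg : HasTaylor g q) (hq : constantCoeff q = 0) :
    HasTaylor (fun t => f (g t)) (p.subst q) := by
  have hs : HasSubst q := HasSubst.of_constantCoeff_zero' hq
  intro n
  obtain ⟨P, ⟨r, hr⟩, h2⟩ := hf n
  obtain ⟨Q, h3, h4⟩ := hg.polynomial_comp P n
  refine ⟨Q, ?_, ?_⟩
  · have h5 : p.subst q - Polynomial.aeval q P = q ^ n * r.subst q := by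
      have := congrArg (subst q) hr
      rwa [subst_sub hs, subst_mul hs, subst_pow hs, subst_X hs, subst_coe hs] at this
    have h6 : X ^ n ∣ p.subst q - Polynomial.aeval q P := by
      rw [h5]
      exact (pow_dvd_pow_of_dvd (X_dvd_iff.2 hq) n).mul_right _
    convert dvd_add h6 h3 using 1
    ring
  · have h5 := (h2.comp_tendsto (hg.tendsto_zero hq)).trans ((hg.isBigO_id hq).pow n)
    refine (h5.add h4).congr_left fun t => ?_
    simp

theorem X_pow_dvd_of_isBigO (n : ℕ) (P : Polynomial ℝ)
    (h : (fun t => P.eval t) =O[𝓝 0] fun t : ℝ => t ^ n) : Polynomial.X ^ n ∣ P := by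
  induction n with
  | zero => simp
  | succ n ih =>
    have h0 : (fun t : ℝ => t ^ (n + 1)) =O[𝓝 0] fun t => t ^ n := by
      simpa [pow_succ] using
        (isBigO_refl (fun t : ℝ => t ^ n) (𝓝 0)).mul (isBigO_eval_one Polynomial.X)
    obtain ⟨S, rfl⟩ := ih (h.trans h0)
    rw [pow_succ]
    refine mul_dvd_mul_left _ (Polynomial.X_dvd_iff.2 ?_)
    -- Dividing by `t ^ n` requires the punctured neighbourhood; continuity of `S` then recovers its
    -- value at `0`.
    have h1 : (fun t => S.eval t) =O[𝓝[≠] 0] fun t : ℝ => t := by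
      obtain ⟨c, hc⟩ := (h.mono (nhdsWithin_le_nhds (s := {0}ᶜ))).bound
      refine IsBigO.of_bound c ?_
      filter_upwards [hc, self_mem_nhdsWithin] with t ht ht0
      have : 0 < ‖t‖ ^ n := pow_pos (norm_pos_iff.2 ht0) n
      rw [Polynomial.eval_mul, Polynomial.eval_pow, Polynomial.eval_X, norm_mul, norm_pow,
        norm_pow, pow_succ, mul_left_comm] at ht
      exact le_of_mul_le_mul_left ht this
    have h2 : Tendsto (fun t => S.eval t) (𝓝[≠] 0) (𝓝 0) :=
      h1.trans_tendsto (tendsto_id.mono_left nhdsWithin_le_nhds)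
    have h3 : Tendsto (fun t => S.eval t) (𝓝[≠] 0) (𝓝 (S.eval 0)) :=
      (S.continuous.tendsto 0).mono_left nhdsWithin_le_nhds
    rw [Polynomial.coeff_zero_eq_eval_zero]
    exact tendsto_nhds_unique h3 h2

theorem unique (hf : HasTaylor f p) (hg : HasTaylor f q) : p = q := by
  ext k
  obtain ⟨P, h1, h2⟩ := hf (k + 1)
  obtain ⟨Q, h3, h4⟩ := hg (k + 1)
  obtain ⟨S, hS⟩ := X_pow_dvd_of_isBigO (k + 1) (P - Q)
    ((h4.sub h2).congr_left fun t => by rw [Polynomial.eval_sub]; ring)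
  have h5 : X ^ (k + 1) ∣ p - q := by
    have h6 : X ^ (k + 1) ∣ (P : PowerSeries ℝ) - (Q : PowerSeries ℝ) :=
      ⟨S, by rw [← Polynomial.coe_sub, hS]; simp⟩
    convert dvd_sub (dvd_add h1 h6) h3 using 1
    ring
  have := X_pow_dvd_iff.1 h5 k (Nat.lt_succ_self k)
  rwa [map_sub, sub_eq_zero] at this

theorem of_analyticAt (hf : AnalyticAt ℝ f 0) :
    HasTaylor f (mk fun n => iteratedDeriv n f 0 / (n.factorial : ℝ)) := by
  intro n
  set p : PowerSeries ℝ := mk fun n => iteratedDeriv n f 0 / (n.factorial : ℝ) with hp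
  refine ⟨trunc n p, ?_, ?_⟩
  · rw [X_pow_dvd_iff]
    intro k hk
    rw [map_sub, Polynomial.coeff_coe, coeff_trunc, if_pos hk, sub_self]
  · refine ((hf.hasFPowerSeriesAt.isBigO_sub_partialSum_pow n).congr_left fun t => ?_).trans
      (IsBigO.of_norm_left ?_)
    · rw [zero_add, FormalMultilinearSeries.partialSum, Polynomial.eval, eval₂_trunc_eq_sum_range]
      congr 1
      refine Finset.sum_congr rfl fun i _ => ?_
      simp [hp, mul_comm]
    · simpa using (isBigO_refl (fun t : ℝ => t ^ n) (𝓝 0)).norm_left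

/-- Uniqueness of expansions upgrades an asymptotic series of an analytic function to a convergent
one. -/
theorem hasFPowerSeriesAt (hf : AnalyticAt ℝ f 0) (hp : HasTaylor f p) :
    HasFPowerSeriesAt f (FormalMultilinearSeries.ofScalars ℝ fun n => coeff n p) 0 := by
  rw [hp.unique (of_analyticAt hf)]
  simpa using hf.hasFPowerSeriesAt

end HasTaylor

end FreeExponentialFamily

/-! ### Cauchy transforms, moment growth and compact support. -/

namespace FreeExponentialFamily

open Filter Topology Asymptotics

/-- The Cauchy-Stieltjes transform at `1/w`: `G_ν(1/w) = ∫ w/(1-wx) ν(dx)`. -/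
noncomputable def cauchyTransform (ν : Measure ℝ) (w : ℝ) : ℝ :=
  ∫ x, w / (1 - w * x) ∂ν

theorem isCompact_support_of_ae_abs_le {ν : Measure ℝ} {r : ℝ}
    (hr : ∀ᵐ x ∂ν, |x| ≤ r) : IsCompact ν.support := by
  refine (isCompact_Icc (a := -r) (b := r)).of_isClosed_subset Measure.isClosed_support
    (Measure.support_subset_of_isClosed isClosed_Icc ?_)
  filter_upwards [hr] with x hx using abs_le.1 hx

theorem exists_ae_abs_le_of_isCompact_support {ν : Measure ℝ}
    (h : IsCompact ν.support) :
    ∃ r, ∀ᵐ x ∂ν, |x| ≤ r := by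
  obtain ⟨r, hr⟩ := h.isBounded.exists_norm_le
  exact ⟨r, Filter.mem_of_superset Measure.support_mem_ae hr⟩

variable {ν : Measure ℝ} [IsProbabilityMeasure ν] {r : ℝ}

theorem half_le_one_sub_mul {w x : ℝ} (hx : |x| ≤ r) (hw : |w| * r ≤ 1 / 2) :
    1 / 2 ≤ 1 - w * x := by
  have h1 : |w * x| ≤ 1 / 2 := by
    rw [abs_mul]
    exact (mul_le_mul_of_nonneg_left hx (abs_nonneg w)).trans hw
  linarith [(abs_le.1 h1).2]

/-- The remainder of the geometric series is `w^(n+1) x^n / (1 - w x)`; the factor `2` comes from `1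
- w x ≥ 1/2`. -/
theorem abs_cauchyTransform_sub_sum_le (hmom : ∀ n : ℕ, Integrable (fun x : ℝ => x ^ n) ν)
    (hr : ∀ᵐ x ∂ν, |x| ≤ r) {w : ℝ} (hw : |w| * r ≤ 1 / 2) (n : ℕ) :
    |cauchyTransform ν w - ∑ k ∈ Finset.range n, (∫ x, x ^ k ∂ν) * w ^ (k + 1)| ≤
      2 * |w| ^ (n + 1) * r ^ n := by
  have hbound : ∀ᵐ x ∂ν, ‖w / (1 - w * x) - ∑ k ∈ Finset.range n, x ^ k * w ^ (k + 1)‖ ≤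
      2 * |w| ^ (n + 1) * r ^ n := by
    filter_upwards [hr] with x hx
    have h1 := half_le_one_sub_mul hx hw
    have h2 : (1 - w * x) ≠ 0 := by linarith
    have h3 : ∑ k ∈ Finset.range n, x ^ k * w ^ (k + 1) =
        w * ((1 - (w * x) ^ n) / (1 - w * x)) := by
      rw [eq_comm, mul_div_assoc', div_eq_iff h2, ← geom_sum_mul_neg, ← mul_assoc, Finset.mul_sum]
      congr 1
      exact Finset.sum_congr rfl fun k _ => by rw [mul_pow]; ring
    have h4 : w / (1 - w * x) - ∑ k ∈ Finset.range n, x ^ k * w ^ (k + 1) =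
        w ^ (n + 1) * x ^ n / (1 - w * x) := by
      rw [h3]; field_simp; ring
    rw [h4, Real.norm_eq_abs, abs_div, abs_mul, abs_pow, abs_pow,
      abs_of_pos (by linarith : 0 < 1 - w * x),
      div_le_iff₀ (by linarith)]
    have h5 : |x| ^ n ≤ r ^ n := pow_le_pow_left₀ (abs_nonneg x) hx n
    have h6 : 0 ≤ |w| ^ (n + 1) := by positivity
    have h7 : 0 ≤ r ^ n := (by positivity : (0 : ℝ) ≤ |x| ^ n).trans h5
    nlinarith [mul_le_mul_of_nonneg_left h5 h6, mul_nonneg h6 h7]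
  have hsum : Integrable (fun x => ∑ k ∈ Finset.range n, x ^ k * w ^ (k + 1)) ν :=
    integrable_finsetSum _ fun k _ => (hmom k).mul_const _
  have hmeas : AEStronglyMeasurable (fun x => w / (1 - w * x)) ν :=
    (by fun_prop : Measurable fun x : ℝ => w / (1 - w * x)).aestronglyMeasurable
  have hint : Integrable (fun x => w / (1 - w * x)) ν := by
    have h1 : Integrable
        (fun x => w / (1 - w * x) - ∑ k ∈ Finset.range n, x ^ k * w ^ (k + 1)) ν :=
      Integrable.of_bound (hmeas.sub hsum.aestronglyMeasurable) _ hbound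
    exact (h1.add hsum).congr (ae_of_all _ fun x => by simp)
  have h1 : cauchyTransform ν w - ∑ k ∈ Finset.range n, (∫ x, x ^ k ∂ν) * w ^ (k + 1) =
      ∫ x, w / (1 - w * x) - ∑ k ∈ Finset.range n, x ^ k * w ^ (k + 1) ∂ν := by
    rw [integral_sub hint hsum, integral_finsetSum _ fun k _ => (hmom k).mul_const _]
    simp only [integral_mul_const]
    rfl
  rw [h1, ← Real.norm_eq_abs]
  simpa using norm_integral_le_of_norm_le_const hbound

theorem eventually_abs_mul_le (r : ℝ) : ∀ᶠ w : ℝ in 𝓝 0, |w| * r ≤ 1 / 2 := by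
  have : Tendsto (fun w : ℝ => |w| * r) (𝓝 0) (𝓝 (|0| * r)) :=
    (by fun_prop : Continuous fun w : ℝ => |w| * r).tendsto 0
  exact this.eventually_le_const (by simp)

theorem hasTaylor_cauchyTransform (hmom : ∀ n : ℕ, Integrable (fun x : ℝ => x ^ n) ν)
    (hr : ∀ᵐ x ∂ν, |x| ≤ r) : HasTaylor (cauchyTransform ν) (cauchySeries ν) := by
  intro n
  refine ⟨∑ k ∈ Finset.range n, Polynomial.C (∫ x, x ^ k ∂ν) * Polynomial.X ^ (k + 1), ?_, ?_⟩
  · rw [PowerSeries.X_pow_dvd_iff]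
    intro m hm
    rw [map_sub, Polynomial.coeff_coe, Polynomial.finsetSum_coeff]
    rcases m with _ | m
    · simp [cauchySeries]
    · rw [cauchySeries, PowerSeries.coeff_succ_X_mul, momentSeries, PowerSeries.coeff_mk]
      simp [Polynomial.coeff_X_pow, (Nat.lt_of_succ_lt hm)]
  · refine IsBigO.trans (g := fun t : ℝ => t ^ (n + 1)) (IsBigO.of_bound (2 * r ^ n) ?_) ?_
    · filter_upwards [eventually_abs_mul_le r] with w hw
      have := abs_cauchyTransform_sub_sum_le hmom hr hw n
      rw [Polynomial.eval_finsetSum]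
      simp only [Polynomial.eval_mul, Polynomial.eval_C, Polynomial.eval_pow, Polynomial.eval_X]
      rw [Real.norm_eq_abs, norm_pow, Real.norm_eq_abs]
      linarith
    · simpa [pow_succ] using (isBigO_refl (fun t : ℝ => t ^ n) (𝓝 0)).mul
        (HasTaylor.isBigO_eval_one Polynomial.X)

theorem hasSum_cauchyTransform (hmom : ∀ n : ℕ, Integrable (fun x : ℝ => x ^ n) ν)
    (hr : ∀ᵐ x ∂ν, |x| ≤ r) {w : ℝ} (hw : |w| * r ≤ 1 / 2) :
    Tendsto (fun n => ∑ k ∈ Finset.range n, (∫ x, x ^ k ∂ν) * w ^ (k + 1)) atTop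
      (𝓝 (cauchyTransform ν w)) := by
  have hr₀ : 0 ≤ r := by
    obtain ⟨x, hx⟩ := hr.exists
    exact (abs_nonneg x).trans hx
  have h1 : Tendsto (fun n : ℕ => 2 * |w| * (|w| * r) ^ n) atTop (𝓝 (2 * |w| * 0)) :=
    (tendsto_pow_atTop_nhds_zero_of_lt_one (by positivity) (by linarith)).const_mul _
  rw [mul_zero] at h1
  rw [tendsto_iff_norm_sub_tendsto_zero]
  refine squeeze_zero (fun _ => norm_nonneg _) (fun n => ?_) h1
  rw [norm_sub_rev, Real.norm_eq_abs]
  refine (abs_cauchyTransform_sub_sum_le hmom hr hw n).trans_eq ?_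
  rw [mul_pow]; ring

/-- A function that is analytic at `0` with Taylor series `cauchySeries ν` is the Cauchy
transform of `ν`. -/
theorem eventually_eq_cauchyTransform (hmom : ∀ n : ℕ, Integrable (fun x : ℝ => x ^ n) ν)
    (hr : ∀ᵐ x ∂ν, |x| ≤ r) {F : ℝ → ℝ} (hF : AnalyticAt ℝ F 0)
    (hT : HasTaylor F (cauchySeries ν)) : F =ᶠ[𝓝 0] cauchyTransform ν := by
  filter_upwards [eventually_abs_mul_le r, (hT.hasFPowerSeriesAt hF).eventually_hasSum] with w hw hs
  rw [zero_add] at hs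
  have h1 := (tendsto_add_atTop_iff_nat 1).2 hs.tendsto_sum_nat
  refine tendsto_nhds_unique h1 ?_
  convert hasSum_cauchyTransform hmom hr hw using 2 with n
  rw [Finset.sum_range_succ']
  simp [cauchySeries, momentSeries, PowerSeries.coeff_succ_X_mul, mul_comm]

/-- If a function that is analytic at `0` has Taylor series `cauchySeries ν`, then `ν` is
compactly supported. -/
theorem exists_ae_abs_le (hmom : ∀ n : ℕ, Integrable (fun x : ℝ => x ^ n) ν)
    {F : ℝ → ℝ} (hF : AnalyticAt ℝ F 0) (hT : HasTaylor F (cauchySeries ν)) :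
    ∃ r, ∀ᵐ x ∂ν, |x| ≤ r := by
  obtain ⟨C, ρ, hC, hρ, hb⟩ := (FormalMultilinearSeries.ofScalars ℝ fun n =>
    PowerSeries.coeff n (cauchySeries ν)).le_mul_pow_of_radius_pos
      (hT.hasFPowerSeriesAt hF).radius_pos
  have hb' : ∀ n, |∫ x, x ^ n ∂ν| ≤ C * ρ ^ (n + 1) := fun n => by
    have := hb (n + 1)
    rw [FormalMultilinearSeries.norm_apply_eq_norm_coef,
      FormalMultilinearSeries.coeff_ofScalars] at this
    simpa [cauchySeries, momentSeries, PowerSeries.coeff_succ_X_mul] using this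
  -- The moments satisfy `|∫ xⁿ dν| ≤ C ρ^(n+1)`. Markov's inequality for the moment of order `2n`
  -- bounds the mass beyond `2ρ` by `C ρ 4⁻ⁿ`, which tends to zero.
  refine ⟨2 * ρ, ?_⟩
  have hmeas : MeasurableSet {x : ℝ | 2 * ρ < |x|} :=
    measurableSet_lt measurable_const continuous_abs.measurable
  have h1 : ∀ n : ℕ, ν.real {x | 2 * ρ < |x|} ≤ C * ρ * (1 / 4) ^ n := fun n => by
    have h2 : (2 * ρ) ^ (2 * n) * ν.real {x | 2 * ρ < |x|} ≤ ∫ x, x ^ (2 * n) ∂ν := by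
      have h3 := mul_meas_ge_le_integral_of_nonneg (μ := ν) (f := fun x : ℝ => x ^ (2 * n))
        (ae_of_all _ fun x => by simp only [pow_mul]; positivity) (hmom (2 * n))
        ((2 * ρ) ^ (2 * n))
      refine (mul_le_mul_of_nonneg_left (measureReal_mono fun x hx => ?_) (by positivity)).trans h3
      have h4 : (2 * ρ) ^ (2 * n) ≤ |x| ^ (2 * n) :=
        pow_le_pow_left₀ (by positivity) (le_of_lt hx) _
      simpa [pow_mul] using h4
    have h5 := h2.trans ((le_abs_self _).trans (hb' (2 * n)))
    have h6 : (0 : ℝ) < (2 * ρ) ^ (2 * n) := by positivity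
    refine le_of_mul_le_mul_left (h5.trans_eq ?_) h6
    rw [mul_pow, pow_mul 2 2 n, pow_succ, one_div, inv_pow]
    norm_num
    field_simp
  have h2 : Tendsto (fun n : ℕ => C * ρ * (1 / 4 : ℝ) ^ n) atTop (𝓝 (C * ρ * 0)) :=
    (tendsto_pow_atTop_nhds_zero_of_lt_one (by norm_num) (by norm_num)).const_mul _
  rw [mul_zero] at h2
  have h3 : ν.real {x | 2 * ρ < |x|} = 0 :=
    le_antisymm (ge_of_tendsto' h2 h1) measureReal_nonneg
  rw [measureReal_eq_zero_iff] at h3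
  rw [ae_iff]
  simpa only [not_le] using h3

end FreeExponentialFamily

/-! ### Germs attached to `V`, and integrals of the densities. -/

namespace FreeExponentialFamily

open Filter Topology

variable {V : ℝ → ℝ} {m₀ : ℝ}

section Analytic

theorem analyticAt_shift (hV : AnalyticAt ℝ V m₀) : AnalyticAt ℝ (fun t => V (m₀ + t)) 0 := by
  refine AnalyticAt.fun_comp (g := V) (by simpa using hV) ?_
  fun_prop

theorem analyticAt_div_shift (hV : AnalyticAt ℝ V m₀) (hV₀ : V m₀ ≠ 0) :
    AnalyticAt ℝ (fun t => t / V (m₀ + t)) 0 :=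
  analyticAt_id.fun_div (analyticAt_shift hV) (by simpa using hV₀)

theorem analyticAt_denominator (hV : AnalyticAt ℝ V m₀) :
    AnalyticAt ℝ (fun t => V (m₀ + t) + (m₀ + t) * t) 0 :=
  (analyticAt_shift hV).fun_add (by fun_prop)

theorem analyticAt_div_denominator (hV : AnalyticAt ℝ V m₀) (hV₀ : V m₀ ≠ 0) :
    AnalyticAt ℝ (fun t => t / (V (m₀ + t) + (m₀ + t) * t)) 0 :=
  analyticAt_id.fun_div (analyticAt_denominator hV) (by simpa using hV₀)

theorem eventually_pos_shift (hV : AnalyticAt ℝ V m₀) (hV₀ : 0 < V m₀) :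
    ∀ᶠ t in 𝓝 0, 0 < V (m₀ + t) :=
  (analyticAt_shift hV).continuousAt.eventually_const_lt (by simpa using hV₀)

theorem eventually_pos_denominator (hV : AnalyticAt ℝ V m₀) (hV₀ : 0 < V m₀) :
    ∀ᶠ t in 𝓝 0, 0 < V (m₀ + t) + (m₀ + t) * t :=
  (analyticAt_denominator hV).continuousAt.eventually_const_lt (by simpa using hV₀)

theorem exists_taylorSeries (hV : AnalyticAt ℝ V m₀) (hV₀ : 0 < V m₀) :
    ∃ v φ w : PowerSeries ℝ, PowerSeries.constantCoeff v ≠ 0 ∧ φ * v = PowerSeries.X ∧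
      w * (v + (PowerSeries.C m₀ + PowerSeries.X) * PowerSeries.X) = PowerSeries.X ∧
      HasTaylor (fun t => t / V (m₀ + t)) φ ∧
      HasTaylor (fun t => t / (V (m₀ + t) + (m₀ + t) * t)) w ∧
      ∀ n : ℕ, PowerSeries.coeff n (v ^ (n + 1)) =
        iteratedDeriv n (fun x => V x ^ (n + 1)) m₀ / (n.factorial : ℝ) := by
  have hv := HasTaylor.of_analyticAt (analyticAt_shift hV)
  have hφ := HasTaylor.of_analyticAt (analyticAt_div_shift hV hV₀.ne')
  have hw := HasTaylor.of_analyticAt (analyticAt_div_denominator hV hV₀.ne')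
  refine ⟨PowerSeries.mk fun n => iteratedDeriv n (fun t => V (m₀ + t)) 0 / (n.factorial : ℝ),
    _, _, ?_, ?_, ?_, hφ, hw, fun n => ?_⟩
  · simpa [← PowerSeries.coeff_zero_eq_constantCoeff_apply] using hV₀.ne'
  · refine (hφ.mul hv).unique (HasTaylor.id.congr ?_)
    filter_upwards [eventually_pos_shift hV hV₀] with t ht
    rw [div_mul_cancel₀ _ ht.ne']
  · refine (hw.mul (hv.add (((HasTaylor.const m₀).add HasTaylor.id).mul HasTaylor.id))).unique
      (HasTaylor.id.congr ?_)
    filter_upwards [eventually_pos_denominator hV hV₀] with t ht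
    rw [div_mul_cancel₀ _ ht.ne']
  · rw [(hv.pow (n + 1)).unique (HasTaylor.of_analyticAt ((analyticAt_shift hV).fun_pow (n + 1))),
      PowerSeries.coeff_mk]
    have := iteratedDeriv_comp_const_add n (fun x => V x ^ (n + 1)) m₀
    simp [this]

/-- If `F` is `φ` composed with the inverse of `w`, both analytic, then the Taylor series of `F`
is determined by that of `φ` and `w`. -/
theorem exists_analyticAt_factorization {φ w : ℝ → ℝ} {p q g : PowerSeries ℝ}
    (hφ : AnalyticAt ℝ φ 0) (hw : AnalyticAt ℝ w 0) (hφp : HasTaylor φ p) (hwq : HasTaylor w q)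
    (hw₀ : w 0 = 0) (hw₁ : deriv w 0 ≠ 0) (hq : PowerSeries.constantCoeff q = 0)
    (hg : g.subst q = p) :
    ∃ F : ℝ → ℝ, AnalyticAt ℝ F 0 ∧ HasTaylor F g ∧ ∀ᶠ t in 𝓝 0, F (w t) = φ t := by
  -- The germ sought is `φ ∘ ω`. Its series is `p ∘ s = g ∘ (q ∘ s) = g`, where `s` is the Taylor
  -- series of `ω`.
  set ω := hw.hasStrictDerivAt.localInverse _ _ _ hw₁ with hω
  have hωa : AnalyticAt ℝ ω 0 := by
    have := hw.analyticAt_localInverse hw₁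
    rwa [hw₀] at this
  have hω₀ : ω 0 = 0 := by
    have : ω (w 0) = 0 := HasStrictFDerivAt.localInverse_apply_image ..
    rwa [hw₀] at this
  have hleft : ∀ᶠ t in 𝓝 0, ω (w t) = t :=
    HasStrictFDerivAt.eventually_left_inverse (hw.hasStrictDerivAt.hasStrictFDerivAt_equiv hw₁)
  have hright : ∀ᶠ t in 𝓝 0, w (ω t) = t := by
    have := HasStrictFDerivAt.eventually_right_inverse
      (hw.hasStrictDerivAt.hasStrictFDerivAt_equiv hw₁)
    rwa [hw₀] at this
  have hωT := HasTaylor.of_analyticAt hωa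
  generalize hs : (PowerSeries.mk fun n => iteratedDeriv n ω 0 / (n.factorial : ℝ)) = s at hωT
  have hs₀ : PowerSeries.constantCoeff s = 0 := by
    rw [← hs, ← PowerSeries.coeff_zero_eq_constantCoeff_apply]
    simp [hω₀]
  have hqs : q.subst s = PowerSeries.X :=
    (hwq.comp hωT hs₀).unique (HasTaylor.id.congr (hright.mono fun t ht => ht.symm))
  refine ⟨fun t => φ (ω t), AnalyticAt.fun_comp (by rwa [hω₀]) hωa, ?_, ?_⟩
  · have h1 := hφp.comp hωT hs₀
    rwa [← hg, PowerSeries.subst_comp_subst_apply (PowerSeries.HasSubst.of_constantCoeff_zero' hq)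
      (PowerSeries.HasSubst.of_constantCoeff_zero' hs₀), hqs, PowerSeries.X_subst] at h1
  · filter_upwards [hleft] with t ht
    rw [ht]

end Analytic

section Integrals

variable {ν : Measure ℝ}

/-- At this argument `w`, `1 - w x` is the denominator of the density divided by `V(m) + m t`, so
the integrands are proportional. -/
theorem cauchyTransform_eq_integral_density {t : ℝ} (hV : V (m₀ + t) ≠ 0)
    (hD : V (m₀ + t) + (m₀ + t) * t ≠ 0) :
    cauchyTransform ν (t / (V (m₀ + t) + (m₀ + t) * t)) =
      t / V (m₀ + t) * ∫ x, density V m₀ (m₀ + t) x ∂ν := by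
  rw [cauchyTransform, ← integral_const_mul]
  congr 1 with x
  have h1 : 1 - t / (V (m₀ + t) + (m₀ + t) * t) * x =
      (V (m₀ + t) + (m₀ + t - m₀) * (m₀ + t - x)) / (V (m₀ + t) + (m₀ + t) * t) := by
    rw [eq_div_iff hD]
    linear_combination (-x) * div_mul_cancel₀ t hD
  rw [h1, div_div_div_cancel_right₀ hD, density, div_mul_div_cancel₀ hV]

theorem measurable_density (V : ℝ → ℝ) (m₀ m : ℝ) : Measurable (density V m₀ m) := by
  unfold density
  fun_prop

theorem integral_member {m : ℝ} (h : ∀ᵐ x ∂ν, 0 ≤ density V m₀ m x) (f : ℝ → ℝ) :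
    ∫ x, f x ∂(member ν V m₀ m) = ∫ x, density V m₀ m x * f x ∂ν := by
  rw [member, integral_withDensity_eq_integral_toReal_smul
    (measurable_density V m₀ m).ennreal_ofReal (ae_of_all _ fun x => ENNReal.ofReal_lt_top)]
  refine integral_congr_ae ?_
  filter_upwards [h] with x hx
  simp [ENNReal.toReal_ofReal hx]

theorem integral_density_eq_one {m : ℝ} (h : ∀ᵐ x ∂ν, 0 ≤ density V m₀ m x)
    (hp : IsProbabilityMeasure (member ν V m₀ m)) : ∫ x, density V m₀ m x ∂ν = 1 := by
  simpa using (integral_member h fun _ => 1).symm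

/-- The density is `V(m)/(V(m) + m t)`, at most `2`, divided by `1 - w x`, at least `1/2`; hence the
bound `4`. -/
theorem density_bounds {t x r : ℝ} (hV : 0 < V (m₀ + t)) (hD : 0 < V (m₀ + t) + (m₀ + t) * t)
    (hq : V (m₀ + t) / (V (m₀ + t) + (m₀ + t) * t) ≤ 2)
    (hw : |t / (V (m₀ + t) + (m₀ + t) * t)| * r ≤ 1 / 2) (hx : |x| ≤ r) :
    0 < V (m₀ + t) + (m₀ + t - m₀) * (m₀ + t - x) ∧ 0 ≤ density V m₀ (m₀ + t) x ∧
      density V m₀ (m₀ + t) x ≤ 4 := by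
  have h1 := half_le_one_sub_mul hx hw
  have h2 : V (m₀ + t) + (m₀ + t - m₀) * (m₀ + t - x) =
      (V (m₀ + t) + (m₀ + t) * t) * (1 - t / (V (m₀ + t) + (m₀ + t) * t) * x) := by
    linear_combination x * div_mul_cancel₀ t hD.ne'
  have h3 : 0 < V (m₀ + t) + (m₀ + t - m₀) * (m₀ + t - x) := by
    rw [h2]
    exact mul_pos hD (by linarith)
  refine ⟨h3, div_nonneg hV.le h3.le, ?_⟩
  rw [density, div_le_iff₀ h3, h2]
  rw [div_le_iff₀ hD] at hq
  nlinarith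

theorem integrable_density_mul {m : ℝ}
    (hb : ∀ᵐ x ∂ν, 0 ≤ density V m₀ m x ∧ density V m₀ m x ≤ 4) {f : ℝ → ℝ}
    (hf : Integrable f ν) : Integrable (fun x => density V m₀ m x * f x) ν := by
  refine hf.bdd_mul (c := 4) (measurable_density V m₀ m).aestronglyMeasurable ?_
  filter_upwards [hb] with x hx
  rw [Real.norm_eq_abs, abs_of_nonneg hx.1]
  exact hx.2

variable [IsProbabilityMeasure ν]

/-- Mass one forces mean `m`: integrate `(m - m₀) ρ (m - x) = V(m) - V(m) ρ` and divide by `m - m₀`.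
-/
theorem integral_density_mul_sub {m : ℝ}
    (hb : ∀ᵐ x ∂ν, 0 < V m + (m - m₀) * (m - x) ∧ 0 ≤ density V m₀ m x ∧ density V m₀ m x ≤ 4)
    (h1 : ∫ x, density V m₀ m x ∂ν = 1) (hm : m ≠ m₀) :
    ∫ x, density V m₀ m x * (m - x) ∂ν = 0 := by
  have hi : Integrable (density V m₀ m) ν := by
    simpa using integrable_density_mul (hb.mono fun x hx => hx.2) (integrable_const (1 : ℝ))
  have h2 : (m - m₀) * ∫ x, density V m₀ m x * (m - x) ∂ν =
      ∫ x, V m - V m * density V m₀ m x ∂ν := by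
    rw [← integral_const_mul]
    refine integral_congr_ae ?_
    filter_upwards [hb] with x hx
    have := div_mul_cancel₀ (V m) hx.1.ne'
    rw [← density] at this
    linear_combination this
  rw [integral_sub (integrable_const _) (hi.const_mul _), integral_const_mul, h1] at h2
  simp only [integral_const, probReal_univ, one_smul, mul_one, sub_self] at h2
  exact (mul_eq_zero.1 h2).resolve_left (sub_ne_zero.2 hm)

/-- Here the same relation is multiplied by `m - x`. The term with `ρ` integrates to zero, and the
mean of `ν` turns the other into `V(m) (m - m₀)`. -/
theorem integral_density_mul_sub_sq {m : ℝ} (hν : Integrable (fun x => x) ν)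
    (hmean : ∫ x, x ∂ν = m₀)
    (hb : ∀ᵐ x ∂ν, 0 < V m + (m - m₀) * (m - x) ∧ 0 ≤ density V m₀ m x ∧ density V m₀ m x ≤ 4)
    (h1 : ∫ x, density V m₀ m x ∂ν = 1) (hm : m ≠ m₀) :
    ∫ x, density V m₀ m x * (x - m) ^ 2 ∂ν = V m := by
  have hsub : Integrable (fun x => m - x) ν := (integrable_const m).sub hν
  have hi : Integrable (fun x => density V m₀ m x * (m - x)) ν :=
    integrable_density_mul (hb.mono fun x hx => hx.2) hsub
  have h2 : (m - m₀) * ∫ x, density V m₀ m x * (x - m) ^ 2 ∂ν =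
      ∫ x, V m * (m - x) - V m * (density V m₀ m x * (m - x)) ∂ν := by
    rw [← integral_const_mul]
    refine integral_congr_ae ?_
    filter_upwards [hb] with x hx
    have := div_mul_cancel₀ (V m) hx.1.ne'
    rw [← density] at this
    linear_combination (m - x) * this
  rw [integral_sub (hsub.const_mul _) (hi.const_mul _), integral_const_mul, integral_const_mul,
    integral_density_mul_sub hb h1 hm, integral_sub (integrable_const _) hν, hmean] at h2
  simp only [integral_const, probReal_univ, one_smul, mul_zero, sub_zero] at h2
  rw [mul_comm (V m)] at h2
  exact mul_left_cancel₀ (sub_ne_zero.2 hm) h2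

theorem density_self (hV₀ : V m₀ ≠ 0) (x : ℝ) : density V m₀ m₀ x = 1 := by
  simp [density, hV₀]

theorem eventually_density_bounds (hV : AnalyticAt ℝ V m₀) (hV₀ : 0 < V m₀) {r : ℝ} :
    ∀ᶠ t in 𝓝 0, ∀ x : ℝ, |x| ≤ r →
      0 < V (m₀ + t) + (m₀ + t - m₀) * (m₀ + t - x) ∧ 0 ≤ density V m₀ (m₀ + t) x ∧
        density V m₀ (m₀ + t) x ≤ 4 := by
  have hq : ∀ᶠ t in 𝓝 0, V (m₀ + t) / (V (m₀ + t) + (m₀ + t) * t) ≤ 2 := by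
    have h1 : ContinuousAt (fun t => V (m₀ + t) / (V (m₀ + t) + (m₀ + t) * t)) 0 :=
      (analyticAt_shift hV).continuousAt.div (analyticAt_denominator hV).continuousAt
        (by simpa using hV₀.ne')
    refine Tendsto.eventually_le_const ?_ h1
    simp [hV₀.ne']
  have hw : ∀ᶠ t in 𝓝 0, |t / (V (m₀ + t) + (m₀ + t) * t)| * r ≤ 1 / 2 := by
    have h1 := (analyticAt_div_denominator hV hV₀.ne').continuousAt
    rw [ContinuousAt, zero_div] at h1
    exact h1.eventually (eventually_abs_mul_le r)
  filter_upwards [eventually_pos_shift hV hV₀, eventually_pos_denominator hV hV₀, hq, hw]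
    with t h1 h2 h3 h4 x hx using density_bounds h1 h2 h3 h4 hx

/-- The variance of `ν` is `V m₀`, as a limit of variances of the nearby members. -/
theorem variance_eq_of_eventually (hV : AnalyticAt ℝ V m₀) (hV₀ : 0 < V m₀) {r : ℝ}
    (hr : ∀ᵐ x ∂ν, |x| ≤ r)
    (h : ∀ᶠ t in 𝓝[≠] 0, ∫ x, density V m₀ (m₀ + t) x * (x - (m₀ + t)) ^ 2 ∂ν = V (m₀ + t)) :
    ∫ x, (x - m₀) ^ 2 ∂ν = V m₀ := by
  have h1 : Tendsto (fun t => ∫ x, density V m₀ (m₀ + t) x * (x - (m₀ + t)) ^ 2 ∂ν) (𝓝[≠] 0)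
      (𝓝 (∫ x, (x - m₀) ^ 2 ∂ν)) := by
    refine tendsto_integral_filter_of_dominated_convergence
      (fun _ => 4 * (r + (|m₀| + 1)) ^ 2) ?_ ?_ (integrable_const _) ?_
    · exact Eventually.of_forall fun t =>
        ((measurable_density V m₀ (m₀ + t)).mul (by fun_prop)).aestronglyMeasurable
    · have h2 : ∀ᶠ t : ℝ in 𝓝 0, |t| ≤ 1 :=
        (continuous_abs.tendsto (0 : ℝ)).eventually_le_const (by simp)
      filter_upwards [nhdsWithin_le_nhds (eventually_density_bounds hV hV₀ (r := r)),
        nhdsWithin_le_nhds h2] with t ht ht1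
      filter_upwards [hr] with x hx
      obtain ⟨-, h3, h4⟩ := ht x hx
      have h5 : |x - (m₀ + t)| ≤ r + (|m₀| + 1) :=
        (abs_sub _ _).trans (add_le_add hx ((abs_add_le _ _).trans (by linarith)))
      rw [norm_mul, norm_pow, Real.norm_eq_abs, Real.norm_eq_abs, abs_of_nonneg h3]
      gcongr
    · refine ae_of_all _ fun x => ?_
      have h2 : ContinuousAt (fun t => density V m₀ (m₀ + t) x * (x - (m₀ + t)) ^ 2) 0 := by
        have hc := (analyticAt_shift hV).continuousAt
        refine ContinuousAt.mul (hc.div (hc.add (by fun_prop)) ?_) (by fun_prop)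
        simpa using hV₀.ne'
      have h3 := h2.tendsto.mono_left (nhdsWithin_le_nhds (s := {0}ᶜ))
      simpa [density_self hV₀.ne'] using h3
  have h2 : Tendsto (fun t => V (m₀ + t)) (𝓝[≠] 0) (𝓝 (V m₀)) := by
    have := (analyticAt_shift hV).continuousAt.tendsto.mono_left (nhdsWithin_le_nhds (s := {0}ᶜ))
    simpa using this
  exact tendsto_nhds_unique h1 (h2.congr' (h.mono fun t ht => ht.symm))

/-- If the densities integrate to `1` near `m₀`, they generate a free exponential family. -/
theorem generates_of_eventually (hV : AnalyticAt ℝ V m₀) (hV₀ : 0 < V m₀) {r : ℝ}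
    (hr : ∀ᵐ x ∂ν, |x| ≤ r) (hmom : ∀ n : ℕ, Integrable (fun x : ℝ => x ^ n) ν)
    (hmean : ∫ x, x ∂ν = m₀)
    (h : ∀ᶠ t in 𝓝[≠] 0, ∫ x, density V m₀ (m₀ + t) x ∂ν = 1) : Generates ν V m₀ := by
  have hν : Integrable (fun x : ℝ => x) ν := by simpa using hmom 1
  have hne : ∀ᶠ t : ℝ in 𝓝[≠] 0, t ≠ 0 := self_mem_nhdsWithin
  -- At `m = m₀` the factor `m - m₀` cannot be cancelled, so the variance of `ν` is obtained as a
  -- limit. Its positivity then excludes point masses.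
  have hvar : ∫ x, (x - m₀) ^ 2 ∂ν = V m₀ := by
    refine variance_eq_of_eventually hV hV₀ hr ?_
    filter_upwards [h, hne, nhdsWithin_le_nhds (eventually_density_bounds hV hV₀ (r := r))]
      with t h1 ht hb
    exact integral_density_mul_sub_sq hν hmean (hr.mono hb) h1 (by simpa using ht)
  refine ⟨?_, isCompact_support_of_ae_abs_le hr, ?_⟩
  · rintro a rfl
    rw [integral_dirac] at hmean hvar
    rw [hmean, sub_self] at hvar
    norm_num at hvar
    exact hV₀.ne hvar
  have h' : ∀ᶠ t in 𝓝 0, ∫ x, density V m₀ (m₀ + t) x ∂ν = 1 := by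
    rw [eventually_nhdsWithin_iff] at h
    filter_upwards [h] with t ht
    by_cases h0 : t = 0
    · simp [h0, density_self hV₀.ne']
    · exact ht h0
  obtain ⟨ε, hε, hball⟩ := Metric.eventually_nhds_iff.1
    (h'.and (eventually_density_bounds hV hV₀ (r := r)))
  have key : ∀ m ∈ Set.Ioo (m₀ - ε) (m₀ + ε), ∫ x, density V m₀ m x ∂ν = 1 ∧
      ∀ x : ℝ, |x| ≤ r → 0 < V m + (m - m₀) * (m - x) ∧ 0 ≤ density V m₀ m x ∧
        density V m₀ m x ≤ 4 := by
    intro m hm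
    have := hball (y := m - m₀) (by
      rw [Real.dist_eq, sub_zero, abs_lt]; constructor <;> linarith [hm.1, hm.2])
    simpa only [add_sub_cancel] using this
  have hnn : ∀ m ∈ Set.Ioo (m₀ - ε) (m₀ + ε), ∀ᵐ x ∂ν, 0 ≤ density V m₀ m x := fun m hm =>
    hr.mono fun x hx => ((key m hm).2 x hx).2.1
  have hint : ∀ m ∈ Set.Ioo (m₀ - ε) (m₀ + ε), ∀ f : ℝ → ℝ, Integrable f ν →
      Integrable (fun x => density V m₀ m x * f x) ν := fun m hm f hf =>
    integrable_density_mul (hr.mono fun x hx => ((key m hm).2 x hx).2) hf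
  refine ⟨m₀ - ε, m₀ + ε, ⟨by linarith, by linarith⟩, fun m hm => ?_, fun m hm => ?_,
    fun m hm => ?_, fun m hm => ?_, fun m hm => ?_⟩
  · filter_upwards [hr] with x hx
    exact ⟨((key m hm).2 x hx).1.ne', ((key m hm).2 x hx).2.1⟩
  · constructor
    have hi : Integrable (density V m₀ m) ν := by
      simpa using hint m hm _ (integrable_const (1 : ℝ))
    rw [member, withDensity_apply _ MeasurableSet.univ, Measure.restrict_univ,
      ← ofReal_integral_eq_lintegral_ofReal hi (hnn m hm), (key m hm).1, ENNReal.ofReal_one]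
  · rw [memLp_two_iff_integrable_sq (f := fun x : ℝ => x) aestronglyMeasurable_id]
    rw [member, integrable_withDensity_iff_integrable_smul'
      (measurable_density V m₀ m).ennreal_ofReal (ae_of_all _ fun x => ENNReal.ofReal_lt_top)]
    refine (hint m hm _ (hmom 2)).congr ?_
    filter_upwards [hnn m hm] with x hx
    simp [ENNReal.toReal_ofReal hx]
  · rw [integral_member (hnn m hm)]
    by_cases h0 : m = m₀
    · simp [h0, density_self hV₀.ne', hmean]
    have hi : Integrable (density V m₀ m) ν := by
      simpa using hint m hm _ (integrable_const (1 : ℝ))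
    have h1 := integral_density_mul_sub (hr.mono (key m hm).2) (key m hm).1 h0
    simp only [mul_sub] at h1
    rw [integral_sub (hi.mul_const m) (hint m hm _ hν), integral_mul_const, (key m hm).1] at h1
    linarith
  · rw [integral_member (hnn m hm)]
    by_cases h0 : m = m₀
    · simp [h0, density_self hV₀.ne', hvar]
    · exact integral_density_mul_sub_sq hν hmean (hr.mono (key m hm).2) (key m hm).1 h0

end Integrals

end FreeExponentialFamily

/-! ### From families to the formal identity and back. -/

namespace FreeExponentialFamily

open Filter Topology

variable {V : ℝ → ℝ} {m₀ : ℝ} {ν : Measure ℝ} [IsProbabilityMeasure ν]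

theorem deriv_div_denominator (hV : AnalyticAt ℝ V m₀) (hV₀ : V m₀ ≠ 0) :
    deriv (fun t => t / (V (m₀ + t) + (m₀ + t) * t)) 0 = (V m₀)⁻¹ := by
  rw [deriv_fun_div (c := fun t : ℝ => t) differentiableAt_id
    (analyticAt_denominator hV).differentiableAt (by simpa using hV₀)]
  simp
  field_simp

theorem constantCoeff_eq_zero_of_mul_eq_X {m₀ : ℝ} {v w : PowerSeries ℝ}
    (hv : PowerSeries.constantCoeff v ≠ 0)
    (hw : w * (v + (PowerSeries.C m₀ + PowerSeries.X) * PowerSeries.X) = PowerSeries.X) :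
    PowerSeries.constantCoeff w = 0 := by
  have := congrArg PowerSeries.constantCoeff hw
  simp only [map_mul, map_add, PowerSeries.constantCoeff_X, mul_zero, add_zero] at this
  exact (mul_eq_zero.1 this).resolve_right hv

theorem subst_cauchySeries_of_generates (hV : AnalyticAt ℝ V m₀) (hV₀ : 0 < V m₀)
    (hmom : ∀ n : ℕ, Integrable (fun x : ℝ => x ^ n) ν) (h : Generates ν V m₀)
    {φ w : PowerSeries ℝ} (hφ : HasTaylor (fun t => t / V (m₀ + t)) φ)
    (hw : HasTaylor (fun t => t / (V (m₀ + t) + (m₀ + t) * t)) w)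
    (hw₀ : PowerSeries.constantCoeff w = 0) : (cauchySeries ν).subst w = φ := by
  obtain ⟨-, hc, A, B, hF⟩ := h
  obtain ⟨r, hr⟩ := exists_ae_abs_le_of_isCompact_support hc
  refine ((hasTaylor_cauchyTransform hmom hr).comp hw hw₀).unique (hφ.congr ?_)
  have hAB : ∀ᶠ t in 𝓝 0, m₀ + t ∈ Set.Ioo A B :=
    (by fun_prop : Continuous fun t : ℝ => m₀ + t).continuousAt.eventually_mem
      (Ioo_mem_nhds (by simpa using hF.mem_interval.1) (by simpa using hF.mem_interval.2))
  filter_upwards [eventually_pos_shift hV hV₀, eventually_pos_denominator hV hV₀, hAB]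
    with t h1 h2 h3
  rw [cauchyTransform_eq_integral_density h1.ne' h2.ne', integral_density_eq_one
    ((hF.density_ok _ h3).mono fun x hx => hx.2) (hF.isProbabilityMeasure _ h3), mul_one]

theorem generates_of_subst_cauchySeries (hV : AnalyticAt ℝ V m₀) (hV₀ : 0 < V m₀)
    (hmom : ∀ n : ℕ, Integrable (fun x : ℝ => x ^ n) ν) (hmean : ∫ x, x ∂ν = m₀)
    {φ w : PowerSeries ℝ} (hφ : HasTaylor (fun t => t / V (m₀ + t)) φ)
    (hw : HasTaylor (fun t => t / (V (m₀ + t) + (m₀ + t) * t)) w)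
    (hw₀ : PowerSeries.constantCoeff w = 0) (h : (cauchySeries ν).subst w = φ) :
    Generates ν V m₀ := by
  obtain ⟨F, hF, hT, hFw⟩ := exists_analyticAt_factorization
    (analyticAt_div_shift hV hV₀.ne') (analyticAt_div_denominator hV hV₀.ne') hφ hw (by simp)
    (by rw [deriv_div_denominator hV hV₀.ne']; exact inv_ne_zero hV₀.ne') hw₀ h
  obtain ⟨r, hr⟩ := exists_ae_abs_le hmom hF hT
  refine generates_of_eventually hV hV₀ hr hmom hmean ?_
  have h1 := (hw.tendsto_zero hw₀).eventually (eventually_eq_cauchyTransform hmom hr hF hT)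
  filter_upwards [nhdsWithin_le_nhds h1, nhdsWithin_le_nhds hFw,
    nhdsWithin_le_nhds (eventually_pos_shift hV hV₀),
    nhdsWithin_le_nhds (eventually_pos_denominator hV hV₀), self_mem_nhdsWithin]
    with t h2 h3 h4 h5 h6
  rw [h3, cauchyTransform_eq_integral_density h4.ne' h5.ne'] at h2
  -- Both sides carry the factor `t / V(m₀ + t)`, which is nonzero off `t = 0`; cancelling it leaves
  -- mass one.
  exact (mul_eq_left₀ (div_ne_zero h6 h4.ne')).1 h2.symm

end FreeExponentialFamily

theorem theorem2 (V : ℝ → ℝ) (m₀ : ℝ) (hV : AnalyticAt ℝ V m₀) (hV₀ : 0 < V m₀)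
    (ν : Measure ℝ) [IsProbabilityMeasure ν]
    (hmom : ∀ n : ℕ, Integrable (fun x : ℝ => x ^ n) ν) (hmean : ∫ x, x ∂ν = m₀) :
    FreeExponentialFamily.Generates ν V m₀ ↔
      (FreeExponentialFamily.freeCumulant ν 1 = m₀ ∧
        ∀ n : ℕ, 1 ≤ n →
          FreeExponentialFamily.freeCumulant ν (n + 1) =
            1 / (n.factorial : ℝ) * iteratedDeriv (n - 1) (fun x => V x ^ n) m₀) := by
  open FreeExponentialFamily in
  obtain ⟨v, φ, w, hv, hφv, hwv, hφ, hw, hcoeff⟩ := exists_taylorSeries hV hV₀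
  have hw₀ := constantCoeff_eq_zero_of_mul_eq_X hv hwv
  have h1 : Generates ν V m₀ ↔ (cauchySeries ν).subst w = φ :=
    ⟨fun h => subst_cauchySeries_of_generates hV hV₀ hmom h hφ hw hw₀,
      generates_of_subst_cauchySeries hV hV₀ hmom hmean hφ hw hw₀⟩
  rw [h1, subst_cauchySeries_eq_iff_freeCumulant ν hv hφv hwv]
  -- The index is shifted by one; the Lagrange factor `n + 1` and the Taylor factor `n!` combine
  -- into `(n + 1)!`.
  have h2 : ∀ n : ℕ, freeCumulant ν (n + 2) * (n + 1) = PowerSeries.coeff n (v ^ (n + 1)) ↔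
      freeCumulant ν (n + 1 + 1) = 1 / ((n + 1).factorial : ℝ) *
        iteratedDeriv (n + 1 - 1) (fun x => V x ^ (n + 1)) m₀ := by
    intro n
    have h3 : (n.factorial : ℝ) ≠ 0 := by positivity
    have h4 : (n + 1 : ℝ) ≠ 0 := by positivity
    rw [hcoeff, Nat.factorial_succ, Nat.add_sub_cancel, ← eq_div_iff h4]
    push_cast
    rw [div_div, one_div_mul_eq_div, mul_comm (n.factorial : ℝ)]
  refine and_congr_right fun _ => ⟨fun h n hn => ?_, fun h n => (h2 n).2 (h (n + 1) (by omega))⟩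
  obtain ⟨n, rfl⟩ := Nat.exists_eq_add_of_le' hn
  exact (h2 n).1 (h n)
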